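/- \textbf{Setting.} Let $\mathcal S$ be a separable metric space (states), $\mathcal A$ and $\Phi$ metric spaces (actions, representations), and $\Xi$ a measurable space (noise); write $\|x-y\|$ for the distance of $x$ and $y$ (for subsets of Euclidean spaces, the $L_2$-norm of the difference). Let $T\in\mathbb N$, $\gamma\in[0,1)$, and let $n\ge 1$ and $m\ge 0$ be integers. Let $\Theta\subseteq\mathbb R^m$ be the set of policy parameters, with $\|\theta\|\le K$ for all $\theta\in\Theta$, where $K>0$. Let $\phi:\mathcal S\to\Phi$ be the encoder, $\pi(\cdot\,;\theta):\Phi\to\mathcal A$ the policy, $f:\mathcal S\to\mathcal S$ the (measurable) distractor, $r:\mathcal S\times\mathcal A\to\mathbb R$ the reward, $\mathcal T,\mathcal T':\mathcal S\times\mathcal A\times\Xi\to\mathcal S$ the (measurable) transitions and $\mathcal I,\mathcal I':\Xi\to\mathcal S$ the (measurable) initializations in the training and in the testing environment. For $\xi=(\xi_0,\dots,\xi_T)\in\Xi^{T+1}$ the trajectory $\tau(\xi;\pi_\theta,\mathcal T,\mathcal I)=(s_0,\dots,s_T)$ is given by $s_0=\mathcal I(\xi_0)$ and $s_{t+1}=\mathcal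 T(s_t,\pi(\phi(s_t);\theta),\xi_t)$, and similarly $\tau(\xi;\pi_\theta,\mathcal T',\mathcal I')=(s'_0,\dots,s'_T)$ with $s'_0=\mathcal I'(\xi_0)$ and $s'_{t+1}=\mathcal T'(s'_t,\pi(\phi(s'_t);\theta),\xi_t)$. The returns are $$J(\phi(\tau(\xi;\pi_\theta,\mathcal T,\mathcal I)))=\sum_{t=0}^T\gamma^t r(s_t,\pi(\phi(s_t);\theta)),\qquad J(\phi(f(\tau(\xi;\pi_\theta,\mathcal T',\mathcal I'))))=\sum_{t=0}^T\gamma^t r(s'_t,\pi(\phi(f(s'_t));\theta)).$$ \textbf{Assumptions.} With constants $L_{t_1},L_{t_2},L_{\pi_1},L_{\pi_2},L_{r_1},L_{r_2},L_\phi\ge 0$ and real numbers $r_{\max},\zeta,\epsilon,\varrho$: $\mathcal T$ is $L_{t_1}$-Lipschitz in $s$ and $L_{t_2}$-Lipschitz in $a$; for parameters in $\Theta$, $\pi(y;\theta)$ is $L_{\pi_1}$-Lipschitz in $y$ and $L_{\pi_2}$-Lipschitz in $\theta$; $|r|\le r_{\max}$, and $r$ is $L_{r_1}$-Lipschitz in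 $s$ and $L_{r_2}$-Lipschitz in $a$; $\phi$ is $L_\phi$-Lipschitz; $\|\mathcal T(s,a,x)-\mathcal T'(s,a,x)\|\le\zeta$, $\|\mathcal I(x)-\mathcal I'(x)\|\le\epsilon$ and $\|\phi(f(s))-\phi(s)\|\le\varrho$ for all $s,a,x$. Let $\xi$ have a probability law $q$ on $\Xi^{T+1}$ and let the noises $\xi_1,\dots,\xi_n$ of the training episodes be i.i.d. with law $q$. Put $\nu=L_{t_1}+L_{t_2}L_{\pi_1}L_\phi$, $\lambda=L_{r_1}+L_{r_2}L_{\pi_1}L_\phi$ and $$L_J=\sum_{t=0}^T\gamma^t\Big(\lambda L_{t_2}L_{\pi_2}\frac{\nu^t-1}{\nu-1}+L_{r_2}L_{\pi_2}\Big),$$ where $\frac{\nu^t-1}{\nu-1}$ stands for $1+\nu+\dots+\nu^{t-1}$ (which is $t$ if $\nu=1$). \textbf{Theorem.} There is an absolute constant $C_1$, and for every $\delta_0\in(0,1)$ a constant $C_2$ depending only on $\delta_0$, such that in every such setting and for every $\delta\in(0,\delta_0]$, with probability at least $1-\delta$ over $\xi_1,\dots,\xi_n$, for all $\theta\in\Theta$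 simultaneously, \begin{align*} &\left|\mathbb E_{\xi\sim q}\big[J(\phi(f(\tau(\xi;\pi_\theta,\mathcal T',\mathcal I'))))\big]-\frac1n\sum_{i=1}^n J(\phi(\tau(\xi_i;\pi_\theta,\mathcal T,\mathcal I)))\right|\\ &\le \lambda\zeta\sum_{t=0}^T\gamma^t\frac{\nu^t-1}{\nu-1}+\lambda\epsilon\sum_{t=0}^T\gamma^t\nu^t+\frac{L_{r_2}L_{\pi_1}\varrho}{1-\gamma}(1-\gamma^{T+1})+C_1L_JK\sqrt{\frac mn}+C_2\,\frac{1-\gamma^{T+1}}{1-\gamma}\,r_{\max}\sqrt{\frac{\log(1/\delta)}{n}}. \end{align*} -/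

import Mathlib

open MeasureTheory ProbabilityTheory

namespace VisualRL

/-- The reparameterized trajectory `s_0, …, s_T` driven by the noise `ξ = (ξ_0, …, ξ_T)`:
`s_0 = init ξ_0` and `s_{t+1} = trans s_t (act s_t) ξ_t`, where `act` is the (deterministic)
map sending a state to the action that drives the dynamics. -/
def trajectory {S A Ξ : Type*} {T : ℕ} (trans : S → A → Ξ → S) (init : Ξ → S) (act : S → A)
    (ξ : Fin (T + 1) → Ξ) : Fin (T + 1) → S :=
  Fin.induction (motive := fun _ => S) (init (ξ 0))
    (fun t s => trans s (act s) (ξ t.castSucc))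

theorem trajectory_zero {S A Ξ : Type*} {T : ℕ} (trans : S → A → Ξ → S) (init : Ξ → S)
    (act : S → A) (ξ : Fin (T + 1) → Ξ) : trajectory trans init act ξ 0 = init (ξ 0) := rfl

theorem trajectory_succ {S A Ξ : Type*} {T : ℕ} (trans : S → A → Ξ → S) (init : Ξ → S)
    (act : S → A) (ξ : Fin (T + 1) → Ξ) (t : Fin T) :
    trajectory trans init act ξ t.succ =
      trans (trajectory trans init act ξ t.castSucc)
        (act (trajectory trans init act ξ t.castSucc)) (ξ t.castSucc) := rfl

/-- The discounted return `∑_{t=0}^T γ^t r(s_t, act s_t)` along a trajectory `s`, where `act`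
is the map sending a state to the action that is rewarded in it. -/
def discountedReturn {S A : Type*} {T : ℕ} (γ : ℝ) (r : S → A → ℝ) (act : S → A)
    (s : Fin (T + 1) → S) : ℝ :=
  ∑ t : Fin (T + 1), γ ^ (t : ℕ) * r (s t) (act (s t))

/-- `J(φ(τ(ξ; π_θ, trans, init)))`: the return of the policy `π(φ(·); θ)`, without distractor. -/
def trainReturn {S A Φ Θ Ξ : Type*} {T : ℕ} (γ : ℝ) (r : S → A → ℝ) (φ : S → Φ)
    (π : Φ → Θ → A) (trans : S → A → Ξ → S) (init : Ξ → S) (θ : Θ) (ξ : Fin (T + 1) → Ξ) : ℝ :=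
  discountedReturn γ r (fun s => π (φ s) θ)
    (trajectory trans init (fun s => π (φ s) θ) ξ)

/-- `J(φ(f(τ(ξ; π_θ, trans', init')))) = ∑_{t=0}^T γ^t r(s'_t, π(φ(f(s'_t)); θ))`: the distractor
`f` is applied to the states of the trajectory `τ(ξ; π_θ, trans', init') = (s'_0, …, s'_T)`,
which is itself generated by `trans'`, `init'` and the policy `π(φ(·); θ)`. -/
def testReturn {S A Φ Θ Ξ : Type*} {T : ℕ} (γ : ℝ) (r : S → A → ℝ) (φ : S → Φ) (f : S → S)
    (π : Φ → Θ → A) (trans' : S → A → Ξ → S) (init' : Ξ → S) (θ : Θ)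
    (ξ : Fin (T + 1) → Ξ) : ℝ :=
  discountedReturn γ r (fun s => π (φ (f s)) θ)
    (trajectory trans' init' (fun s => π (φ s) θ) ξ)

/-- `(ν^t - 1) / (ν - 1)`, read as the sum `1 + ν + ⋯ + ν^(t-1)`, so that its value at `ν = 1`
is `t`. -/
def geomQuotient (ν : ℝ) (t : ℕ) : ℝ := ∑ k ∈ Finset.range t, ν ^ k

theorem geomQuotient_eq {ν : ℝ} (hν : ν ≠ 1) (t : ℕ) :
    geomQuotient ν t = (ν ^ t - 1) / (ν - 1) := geom_sum_eq hν t

/-- The Lipschitz constant of the return in the policy parameter: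
`L_J = ∑_{t=0}^T γ^t (λ L_{t₂} L_{π₂} (ν^t - 1)/(ν - 1) + L_{r₂} L_{π₂})`. -/
noncomputable def returnLipschitzConst (T : ℕ) (γ lam ν Lt₂ Lπ₂ Lr₂ : ℝ) : ℝ :=
  ∑ t ∈ Finset.range (T + 1), γ ^ t * (lam * Lt₂ * Lπ₂ * geomQuotient ν t + Lr₂ * Lπ₂)

end VisualRL

/-! The error splits into a bias, test return minus training return in expectation, and a deviation,
mean minus sample average of the training return.

The bias is bounded for each noise separately: two trajectories driven by the same noise obey
d_{t+1} ≤ ν d_t + c, so a discrete Grönwall bound (`dist_trajectory_le`) controls their distance,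
and the Lipschitz reward transfers this to the returns. The same bound with perturbed parameters
instead of perturbed dynamics shows that the training return is L_J-Lipschitz in θ.

The deviation is bounded uniformly in θ by chaining for a class that is L-Lipschitz in θ and bounded
by M (`exists_event_uniform_deviation`). Hoeffding's inequality is applied to a coarse net and to
the links between nets of scales a/2^k. A net has at most (3·2^k·K/a)^m points; bounding log(K/a)
crudely by K/a is harmless, because links have size about La/2^k and La·(K/a) = LK. The scale a is K
if LK ≤ M and M/L otherwise: then La ≤ M, and the entropy of the coarsest net also costs only
O(LK√(m/n)). So no logarithmic factor appears. -/

namespace VisualRL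

/-! ### Metric entropy of bounded sets in finite dimension. -/

section Nets

variable {E : Type*} [NormedAddCommGroup E] [NormedSpace ℝ E] [FiniteDimensional ℝ E]

open Metric Module in
/-- Volume bound for separated sets in a ball. -/
theorem card_le_of_separated_of_norm_le {K η : ℝ} (hη : 0 < η) (hηK : η ≤ K) (s : Finset E)
    (hs : ∀ c ∈ s, ‖c‖ ≤ K) (h : ∀ c ∈ s, ∀ d ∈ s, c ≠ d → η ≤ ‖c - d‖) :
    (s.card : ℝ) ≤ (3 * K / η) ^ finrank ℝ E := by
  borelize E
  let μ : Measure E := Measure.addHaar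
  have hη2 : 0 < η / 2 := by positivity
  have hρ : 0 < K + η / 2 := by linarith
  -- Disjoint balls of radius η/2 inside the ball of radius K + η/2: comparing volumes gives the
  -- bound (1 + 2K/η)^dim, and η ≤ K makes the base at most 3K/η.
  have hD : (s : Set E).PairwiseDisjoint fun c => ball c (η / 2) := by
    rintro c hc d hd hcd
    apply ball_disjoint_ball
    rw [dist_eq_norm]
    linarith [h c hc d hd hcd]
  have hsub : (⋃ c ∈ s, ball c (η / 2)) ⊆ ball (0 : E) (K + η / 2) := by
    refine Set.iUnion₂_subset fun x hx => ball_subset_ball' ?_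
    rw [dist_zero_right]
    linarith [hs x hx]
  have I : (s.card : ENNReal) * ENNReal.ofReal ((η / 2) ^ finrank ℝ E) * μ (ball 0 1) ≤
      ENNReal.ofReal ((K + η / 2) ^ finrank ℝ E) * μ (ball 0 1) :=
    calc
      _ = μ (⋃ c ∈ s, ball c (η / 2)) := by
        rw [measure_biUnion_finset hD fun c _ => measurableSet_ball]
        simp only [μ.addHaar_ball_of_pos _ hη2, Finset.sum_const, nsmul_eq_mul, mul_assoc]
      _ ≤ μ (ball (0 : E) (K + η / 2)) := measure_mono hsub
      _ = _ := μ.addHaar_ball_of_pos _ hρ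
  have J := (ENNReal.mul_le_mul_iff_left (measure_ball_pos μ _ zero_lt_one).ne'
    measure_ball_lt_top.ne).1 I
  have J' := ENNReal.toReal_le_of_le_ofReal (pow_nonneg hρ.le _) J
  rw [ENNReal.toReal_mul, ENNReal.toReal_natCast, ENNReal.toReal_ofReal (by positivity),
    ← le_div_iff₀ (by positivity), ← div_pow] at J'
  refine J'.trans (pow_le_pow_left₀ (by positivity) ?_ _)
  rw [div_le_div_iff₀ hη2 hη]
  nlinarith

open Module in
/-- A bounded subset of a finite-dimensional space has small internal nets. -/
theorem exists_finset_net (Θ : Set E) {K η : ℝ} (hη : 0 < η) (hηK : η ≤ K)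
    (hΘ : ∀ θ ∈ Θ, ‖θ‖ ≤ K) :
    ∃ N : Finset E, (∀ θ ∈ N, θ ∈ Θ) ∧ (N.card : ℝ) ≤ (3 * K / η) ^ finrank ℝ E ∧
      ∀ θ ∈ Θ, ∃ θ' ∈ N, ‖θ - θ'‖ ≤ η := by
  classical
  -- A separated subset of Θ of maximal cardinality is a net, since an uncovered point could be
  -- added to it. Its points lie in Θ, the only place where the function class is controlled.
  let S : Set ℕ := {k | ∃ s : Finset E, s.card = k ∧ (∀ θ ∈ s, θ ∈ Θ) ∧
    ∀ c ∈ s, ∀ d ∈ s, c ≠ d → η ≤ ‖c - d‖}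
  have hbound : ∀ s : Finset E, (∀ θ ∈ s, θ ∈ Θ) →
      (∀ c ∈ s, ∀ d ∈ s, c ≠ d → η ≤ ‖c - d‖) → (s.card : ℝ) ≤ (3 * K / η) ^ finrank ℝ E :=
    fun s hs h => card_le_of_separated_of_norm_le hη hηK s (fun c hc => hΘ c (hs c hc)) h
  have hS : BddAbove S := by
    refine ⟨⌈(3 * K / η) ^ finrank ℝ E⌉₊, ?_⟩
    rintro _ ⟨s, rfl, hs, h⟩
    exact_mod_cast (hbound s hs h).trans (Nat.le_ceil _)
  have hS0 : S.Nonempty := ⟨0, ∅, by simp⟩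
  obtain ⟨N, hcard, hN, hsep⟩ := Nat.sSup_mem hS0 hS
  refine ⟨N, hN, hbound N hN hsep, fun θ hθ => ?_⟩
  by_contra! hcon
  have hθN : θ ∉ N := fun hmem => by
    have := hcon θ hmem
    simp only [sub_self, norm_zero] at this
    linarith
  have hmem : (insert θ N).card ∈ S := by
    refine ⟨insert θ N, rfl, ?_, ?_⟩
    · intro c hc
      rcases Finset.mem_insert.1 hc with rfl | hc
      exacts [hθ, hN c hc]
    · intro c hc d hd hcd
      rcases Finset.mem_insert.1 hc with rfl | hc <;> rcases Finset.mem_insert.1 hd with hdeq | hd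
      · exact absurd hdeq.symm hcd
      · exact (hcon d hd).le
      · rw [hdeq, norm_sub_rev]; exact (hcon c hc).le
      · exact hsep c hc d hd hcd
  have := le_csSup hS hmem
  rw [Finset.card_insert_of_notMem hθN, ← hcard] at this
  omega

end Nets

/-! ### Hoeffding's inequality for empirical means. -/

section Deviation

variable {α Ω : Type*} [MeasurableSpace α] {n : ℕ}

/-- The difference between the mean of `g` and its average over the sample `ξ`. -/
noncomputable def deviation (q : Measure α) (ξ : Fin n → Ω → α) (g : α → ℝ) (ω : Ω) : ℝ :=
  ∫ x, g x ∂q - (1 / (n : ℝ)) * ∑ i, g (ξ i ω)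

variable {q : Measure α} {ξ : Fin n → Ω → α}

theorem measurable_deviation [MeasurableSpace Ω] (hξ : ∀ i, Measurable (ξ i)) {g : α → ℝ} (hg : Measurable g) :
    Measurable (deviation q ξ g) := by
  unfold deviation
  exact measurable_const.sub
    ((Finset.measurable_sum _ fun i _ => hg.comp (hξ i)).const_mul _)

theorem integrable_of_abs_le [IsProbabilityMeasure q] {g : α → ℝ} (hg : Measurable g) {b : ℝ} (hb : ∀ x, |g x| ≤ b) :
    Integrable g q :=
  Integrable.of_bound hg.aestronglyMeasurable b (Filter.Eventually.of_forall hb)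

theorem deviation_sub {g g' : α → ℝ} (hg : Integrable g q) (hg' : Integrable g' q) (ω : Ω) :
    deviation q ξ g ω - deviation q ξ g' ω = deviation q ξ (fun x => g x - g' x) ω := by
  simp only [deviation, integral_sub hg hg', Finset.sum_sub_distrib]
  ring

theorem abs_deviation_le [IsProbabilityMeasure q] {g : α → ℝ} {b : ℝ} (hb0 : 0 ≤ b)
    (hb : ∀ x, |g x| ≤ b) (ω : Ω) : |deviation q ξ g ω| ≤ 2 * b := by
  have h1 : |∫ x, g x ∂q| ≤ b := by
    have := norm_integral_le_of_norm_le_const (μ := q) (f := g) (Filter.Eventually.of_forall hb)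
    simpa using this
  have h2 : |(1 / (n : ℝ)) * ∑ i, g (ξ i ω)| ≤ b := by
    rw [abs_mul, abs_of_nonneg (by positivity : 0 ≤ 1 / (n : ℝ))]
    have h3 : |∑ i, g (ξ i ω)| ≤ n * b := by
      refine (Finset.abs_sum_le_sum_abs _ _).trans ((Finset.sum_le_sum fun i _ => hb _).trans ?_)
      simp
    rcases Nat.eq_zero_or_pos n with rfl | hn
    · simpa using hb0
    · have hn' : (0 : ℝ) < n := by exact_mod_cast hn
      calc 1 / (n : ℝ) * |∑ i, g (ξ i ω)| ≤ 1 / (n : ℝ) * (n * b) := by gcongr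
        _ = b := by field_simp
  unfold deviation
  linarith [abs_sub (∫ x, g x ∂q) ((1 / (n : ℝ)) * ∑ i, g (ξ i ω))]

variable [IsProbabilityMeasure q] [MeasurableSpace Ω] {P : Measure Ω}

/-- One-sided Hoeffding bound. -/
theorem measure_deviation_neg_le (hn : 0 < n) (hξ : ∀ i, Measurable (ξ i))
    (hind : iIndepFun ξ P) (hlaw : ∀ i, P.map (ξ i) = q) {g : α → ℝ} (hg : Measurable g) {b : ℝ}
    (hb0 : 0 < b) (hb : ∀ x, |g x| ≤ b) {l : ℝ} (hl : 0 ≤ l) :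
    P.real {ω | b * √(2 * l / n) ≤ -deviation q ξ g ω} ≤ Real.exp (-l) := by
  have hn' : (0 : ℝ) < n := by exact_mod_cast hn
  -- Hoeffding's lemma on [-b, b], an interval of length 2b, gives variance proxy b².
  have hsub : HasSubgaussianMGF (fun x => g x - q[g]) ((‖b - -b‖₊ / 2) ^ 2) q :=
    hasSubgaussianMGF_of_mem_Icc hg.aemeasurable
      (Filter.Eventually.of_forall fun x => abs_le.1 (hb x))
  have hc : ((‖b - -b‖₊ / 2) ^ 2 : NNReal) = b.toNNReal ^ 2 := by
    congr 1
    ext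
    rw [NNReal.coe_div, coe_nnnorm, NNReal.coe_ofNat, Real.norm_eq_abs, abs_of_pos (by linarith),
      Real.coe_toNNReal b hb0.le]
    ring
  rw [hc] at hsub
  have hsubi : ∀ i ∈ (Finset.univ : Finset (Fin n)),
      HasSubgaussianMGF ((fun x => g x - q[g]) ∘ ξ i) (b.toNNReal ^ 2) P := by
    intro i _
    refine HasSubgaussianMGF.of_map (hξ i).aemeasurable ?_
    rw [hlaw i]
    exact hsub
  have hindi : iIndepFun (fun i => (fun x => g x - q[g]) ∘ ξ i) P :=
    hind.comp _ fun i => hg.sub_const _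
  have hmain := HasSubgaussianMGF.measure_sum_ge_le_of_iIndepFun hindi hsubi
    (ε := n * (b * √(2 * l / n))) (by positivity)
  have hset : {ω | b * √(2 * l / n) ≤ -deviation q ξ g ω} =
      {ω | n * (b * √(2 * l / n)) ≤ ∑ i, ((fun x => g x - q[g]) ∘ ξ i) ω} := by
    ext ω
    have : ∑ i, ((fun x => g x - q[g]) ∘ ξ i) ω = n * -deviation q ξ g ω := by
      simp only [deviation, Function.comp, Finset.sum_sub_distrib, Finset.sum_const,
        Finset.card_univ, Fintype.card_fin, nsmul_eq_mul]
      field_simp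
      ring
    rw [Set.mem_ofPred_eq, Set.mem_ofPred_eq, this, mul_le_mul_iff_right₀ hn']
  rw [hset]
  refine hmain.trans (Real.exp_le_exp.2 (le_of_eq ?_))
  simp only [Finset.sum_const, Finset.card_univ, Fintype.card_fin, nsmul_eq_mul, NNReal.coe_mul,
    NNReal.coe_natCast, NNReal.coe_pow, Real.coe_toNNReal b hb0.le]
  rw [mul_pow, mul_pow, Real.sq_sqrt (by positivity)]
  field_simp

/-- Hoeffding bound for the deviation of a bounded function. -/
theorem measure_abs_deviation_gt_le [IsProbabilityMeasure P] (hn : 0 < n) (hξ : ∀ i, Measurable (ξ i))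
    (hind : iIndepFun ξ P) (hlaw : ∀ i, P.map (ξ i) = q) {g : α → ℝ} (hg : Measurable g) {b : ℝ}
    (hb0 : 0 ≤ b) (hb : ∀ x, |g x| ≤ b) {l : ℝ} (hl : 0 ≤ l) :
    P {ω | b * √(2 * l / n) < |deviation q ξ g ω|} ≤ ENNReal.ofReal (2 * Real.exp (-l)) := by
  -- For b = 0 the deviation vanishes, and the strict inequality makes the event empty.
  rcases hb0.eq_or_lt with rfl | hb0
  · have : {ω | 0 * √(2 * l / n) < |deviation q ξ g ω|} = ∅ := by
      ext ω
      have := abs_deviation_le (q := q) (ξ := ξ) le_rfl hb ω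
      simp only [zero_mul, Set.mem_ofPred_eq, Set.mem_empty_iff_false, iff_false, not_lt]
      linarith
    rw [this]
    simp
  · have h1 := measure_deviation_neg_le hn hξ hind hlaw hg hb0 hb hl
    have h2 := measure_deviation_neg_le hn hξ hind hlaw hg.neg hb0
      (fun x => by simpa using hb x) hl
    have hneg : ∀ ω, deviation q ξ (-g) ω = -deviation q ξ g ω := by
      intro ω
      simp only [deviation, Pi.neg_apply, integral_neg, Finset.sum_neg_distrib]
      ring
    simp only [hneg, neg_neg] at h2
    have hsub : {ω | b * √(2 * l / n) < |deviation q ξ g ω|} ⊆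
        {ω | b * √(2 * l / n) ≤ -deviation q ξ g ω} ∪
          {ω | b * √(2 * l / n) ≤ deviation q ξ g ω} := by
      intro ω hω
      have hω' : b * √(2 * l / n) < |deviation q ξ g ω| := hω
      rcases lt_abs.1 hω' with h | h
      exacts [Or.inr h.le, Or.inl h.le]
    rw [← ofReal_measureReal]
    refine ENNReal.ofReal_le_ofReal ?_
    have h3 := (measureReal_mono (μ := P) hsub).trans (measureReal_union_le _ _)
    linarith

end Deviation

/-- Summation of the increments of a chain that decrease geometrically. -/
theorem abs_le_of_chain {z : ℕ → ℝ} {x B c : ℝ} (hc : 0 ≤ c) (h0 : |z 0| ≤ B)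
    (h : ∀ k, |z k - z (k + 1)| ≤ c * ((k + 3) / 2 ^ k))
    (hlim : Filter.Tendsto z Filter.atTop (nhds x)) : |x| ≤ B + 8 * c := by
  -- The series ∑ (k + 3)/2^k equals 8, with tail (2N + 8)/2^N from index N on.
  have hN : ∀ N : ℕ, |z N| ≤ B + c * (8 - (2 * N + 8) / 2 ^ N) := by
    intro N
    induction N with
    | zero => simpa using h0
    | succ N ih =>
      have h1 : |z (N + 1)| ≤ |z N| + |z N - z (N + 1)| := by
        have := abs_sub (z N) (z N - z (N + 1))
        simpa using this
      have h2 : c * (8 - (2 * N + 8) / 2 ^ N) + c * ((N + 3) / 2 ^ N)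
          = c * (8 - (2 * ((N + 1 : ℕ) : ℝ) + 8) / 2 ^ (N + 1)) := by
        push_cast
        field_simp
        ring
      linarith [h N]
  refine le_of_tendsto hlim.abs (Filter.Eventually.of_forall fun N => (hN N).trans ?_)
  have : 0 ≤ (2 * (N : ℝ) + 8) / 2 ^ N := by positivity
  nlinarith

/-! ### Chaining: uniform deviation over a Lipschitz family. -/

section Chaining

variable {α Ω : Type*} [MeasurableSpace α] [MeasurableSpace Ω] {n : ℕ}
  {q : Measure α} [IsProbabilityMeasure q] {P : Measure Ω} [IsProbabilityMeasure P]
  {ξ : Fin n → Ω → α}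

/-- A union bound over countably many finite levels of bounded functions. -/
theorem exists_event_forall_abs_deviation_le (hn : 0 < n) (hξ : ∀ i, Measurable (ξ i))
    (hind : iIndepFun ξ P) (hlaw : ∀ i, P.map (ξ i) = q) {κ : Type*} (s : ℕ → Finset κ)
    (g : κ → α → ℝ) (b : κ → ℝ) (e : ℕ → ℝ) (he : ∀ k, 0 ≤ e k)
    (hg : ∀ k, ∀ i ∈ s k, Measurable (g i)) (hb0 : ∀ i, 0 ≤ b i)
    (hb : ∀ k, ∀ i ∈ s k, ∀ x, |g i x| ≤ b i) (hcard : ∀ k, ((s k).card : ℝ) ≤ Real.exp (e k))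
    {δ : ℝ} (hδ : 0 < δ) (hδ1 : δ < 1) :
    ∃ G : Set Ω, MeasurableSet G ∧ 1 - δ ≤ P.real G ∧ ∀ ω ∈ G, ∀ k, ∀ i ∈ s k,
      |deviation q ξ (g i) ω| ≤ b i * √(2 * (e k + (k + 2) + Real.log (1 / δ)) / n) := by
  have hlog : 0 ≤ Real.log (1 / δ) := Real.log_nonneg (by rw [le_div_iff₀ hδ]; linarith)
  -- Here e k pays for the cardinality of level k and k + 2 makes the failure probabilities
  -- summable: level k fails with probability at most 2δ exp(-(k + 2)) ≤ (δ/2)·2^(-k), which sums to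
  -- δ.
  set l : ℕ → ℝ := fun k => e k + (k + 2) + Real.log (1 / δ) with hl
  have hl0 : ∀ k, 0 ≤ l k := fun k => by have := he k; positivity
  have hexp : ∀ k, Real.exp (e k) * (2 * Real.exp (-l k)) ≤ δ / 2 * (1 / 2) ^ k := by
    intro k
    have h1 : Real.exp (e k) * (2 * Real.exp (-l k)) = 2 * δ * Real.exp (-1) ^ (k + 2) := by
      have : -l k = -e k + ((k + 2 : ℕ) * (-1) + Real.log δ) := by
        simp only [hl, one_div, Real.log_inv]
        push_cast
        ring
      rw [this, Real.exp_add, Real.exp_add, Real.exp_log hδ, Real.exp_nat_mul, Real.exp_neg]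
      field_simp
    have h2 : Real.exp (-1) ≤ 1 / 2 := by
      rw [Real.exp_neg, ← one_div]
      exact one_div_le_one_div_of_le two_pos (by linarith [Real.add_one_le_exp (1 : ℝ)])
    rw [h1]
    calc 2 * δ * Real.exp (-1) ^ (k + 2) ≤ 2 * δ * (1 / 2) ^ (k + 2) := by gcongr
      _ = δ / 2 * (1 / 2) ^ k := by ring
  -- A countable intersection is measurable, so no measurability of a supremum over Θ is needed.
  set G : Set Ω := ⋂ k, ⋂ i ∈ s k, {ω | |deviation q ξ (g i) ω| ≤ b i * √(2 * l k / n)} with hG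
  have hGm : MeasurableSet G := by
    refine MeasurableSet.iInter fun k => Finset.measurableSet_biInter _ fun i hi => ?_
    exact measurableSet_le (measurable_deviation hξ (hg k i hi)).abs measurable_const
  have hGc : P Gᶜ ≤ ENNReal.ofReal δ := by
    have hGc' : Gᶜ = ⋃ k, ⋃ i ∈ s k, {ω | b i * √(2 * l k / n) < |deviation q ξ (g i) ω|} := by
      simp only [hG, Set.compl_iInter]
      congr! 5 with k i hi
      ext ω
      simp
    rw [hGc']
    refine (measure_iUnion_le _).trans ?_
    have hlevel : ∀ k, P (⋃ i ∈ s k, {ω | b i * √(2 * l k / n) < |deviation q ξ (g i) ω|})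
        ≤ ENNReal.ofReal (δ / 2 * (1 / 2) ^ k) := by
      intro k
      calc _ ≤ ∑ i ∈ s k, P {ω | b i * √(2 * l k / n) < |deviation q ξ (g i) ω|} :=
            measure_biUnion_finset_le _ _
        _ ≤ ∑ _i ∈ s k, ENNReal.ofReal (2 * Real.exp (-l k)) :=
            Finset.sum_le_sum fun i hi => measure_abs_deviation_gt_le hn hξ hind hlaw
              (hg k i hi) (hb0 i) (hb k i hi) (hl0 k)
        _ = ENNReal.ofReal ((s k).card * (2 * Real.exp (-l k))) := by
            rw [Finset.sum_const, nsmul_eq_mul, ENNReal.ofReal_mul (Nat.cast_nonneg _),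
              ENNReal.ofReal_natCast]
        _ ≤ _ := ENNReal.ofReal_le_ofReal ((mul_le_mul_of_nonneg_right (hcard k)
              (by positivity)).trans (hexp k))
    refine (ENNReal.tsum_le_tsum hlevel).trans ?_
    rw [← ENNReal.ofReal_tsum_of_nonneg (fun k => by positivity)
      (summable_geometric_two.mul_left _), tsum_mul_left, tsum_geometric_two]
    exact ENNReal.ofReal_le_ofReal (by linarith)
  refine ⟨G, hGm, ?_, fun ω hω k i hi => ?_⟩
  · have h1 : P.real Gᶜ ≤ δ := ENNReal.toReal_le_of_le_ofReal hδ.le hGc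
    rw [probReal_compl_eq_one_sub hGm] at h1
    linarith
  · exact Set.mem_iInter₂.1 (Set.mem_iInter.1 hω k) i hi

/-- Separates entropy from confidence by subadditivity of the square root. Since l ≥ l₀ > 0, the
additive k + 3 is absorbed into a multiple of l; this is where the dependence on δ₀ enters. -/
theorem sqrt_link_le {m n D l l₀ : ℝ} (k : ℕ) (hm : 0 ≤ m) (hn : 0 < n) (hD : 1 ≤ D)
    (hl₀ : 0 < l₀) (hl : l₀ ≤ l) :
    √(2 * (2 * m * (k + 3) * D + (k + 3) + l) / n)
      ≤ (k + 3) * (2 * D * √(m / n) + √(2 * (2 / l₀ + 1)) * √(l / n)) := by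
  have hl' : 0 < l := hl₀.trans_le hl
  have h1 : 1 ≤ l / l₀ := by rwa [le_div_iff₀ hl₀, one_mul]
  have hk : (0 : ℝ) ≤ k := k.cast_nonneg
  rw [Real.sqrt_le_left (by positivity)]
  have hx : √(m / n) ^ 2 = m / n := Real.sq_sqrt (by positivity)
  have hy : √(2 * (2 / l₀ + 1)) ^ 2 = 2 * (2 / l₀ + 1) := Real.sq_sqrt (by positivity)
  have hz : √(l / n) ^ 2 = l / n := Real.sq_sqrt (by positivity)
  calc 2 * (2 * m * (k + 3) * D + (k + 3) + l) / n
      ≤ ((k + 3) ^ 2 * (4 * D ^ 2 * m + 2 * (2 / l₀ + 1) * l)) / n := by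
        refine div_le_div_of_nonneg_right ?_ hn.le
        have e1 : m * D * (k + 3) ≤ (k + 3) ^ 2 * (D ^ 2 * m) := by
          have : 1 ≤ (k + 3) * D := by nlinarith
          have h0 : 0 ≤ m * D * (k + 3) := by positivity
          nlinarith
        have e2 : (k + 3) + l ≤ (k + 3) ^ 2 * ((2 / l₀ + 1) * l) := by
          have : (2 / l₀ + 1) * l = 2 * (l / l₀) + l := by ring
          rw [this]
          have h3 : (1 : ℝ) ≤ k + 3 := by linarith
          have h4 : (k : ℝ) + 3 ≤ (k + 3) ^ 2 := by nlinarith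
          have h5 : ((k : ℝ) + 3) ^ 2 * 1 ≤ (k + 3) ^ 2 * (l / l₀) := by gcongr
          have h6 : 1 * l ≤ ((k : ℝ) + 3) ^ 2 * l := by
            gcongr
            linarith
          nlinarith
        nlinarith
    _ = (k + 3) ^ 2 * ((2 * D * √(m / n)) ^ 2 + (√(2 * (2 / l₀ + 1)) * √(l / n)) ^ 2) := by
        rw [mul_pow, mul_pow _ (√(l / n)), hx, hy, hz]
        ring
    _ ≤ ((k + 3) * (2 * D * √(m / n) + √(2 * (2 / l₀ + 1)) * √(l / n))) ^ 2 := by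
        rw [mul_pow ((k : ℝ) + 3)]
        refine mul_le_mul_of_nonneg_left ?_ (by positivity)
        have : 0 ≤ (2 * D * √(m / n)) * (√(2 * (2 / l₀ + 1)) * √(l / n)) := by positivity
        nlinarith

/-- The same separation for the coarsest net. The condition M²h ≤ 4B² turns its entropy cost into a
multiple of B, applied with B = LK; the factor 3 comes from 8 ≤ 9. -/
theorem mul_sqrt_start_le {m n M h B l l₀ : ℝ} (hm : 0 ≤ m) (hn : 0 < n) (hM : 0 ≤ M) (hh : 0 ≤ h)
    (hB : 0 ≤ B) (hMh : M ^ 2 * h ≤ 4 * B ^ 2) (hl₀ : 0 < l₀) (hl : l₀ ≤ l) :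
    M * √(2 * (m * h + 2 + l) / n)
      ≤ 3 * (B * √(m / n)) + √(2 * (2 / l₀ + 1)) * (M * √(l / n)) := by
  have hl' : 0 < l := hl₀.trans_le hl
  have h1 : 1 ≤ l / l₀ := by rwa [le_div_iff₀ hl₀, one_mul]
  have hx : √(m / n) ^ 2 = m / n := Real.sq_sqrt (by positivity)
  have hy : √(2 * (2 / l₀ + 1)) ^ 2 = 2 * (2 / l₀ + 1) := Real.sq_sqrt (by positivity)
  have hz : √(l / n) ^ 2 = l / n := Real.sq_sqrt (by positivity)
  refine abs_le_of_sq_le_sq' ?_ (by positivity) |>.2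
  have hu : √(2 * (m * h + 2 + l) / n) ^ 2 = 2 * (m * h + 2 + l) / n :=
    Real.sq_sqrt (by positivity)
  calc (M * √(2 * (m * h + 2 + l) / n)) ^ 2
      = (2 * m * (M ^ 2 * h) + M ^ 2 * (4 + 2 * l)) / n := by rw [mul_pow, hu]; ring
    _ ≤ (2 * m * (4 * B ^ 2) + M ^ 2 * (2 * (2 / l₀ + 1) * l)) / n := by
        gcongr
        have : 2 * (2 / l₀ + 1) * l = 4 * (l / l₀) + 2 * l := by ring
        linarith
    _ ≤ (9 * B ^ 2 * m + M ^ 2 * (2 * (2 / l₀ + 1) * l)) / n := by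
        refine div_le_div_of_nonneg_right ?_ hn.le
        nlinarith [mul_nonneg hm (sq_nonneg B)]
    _ = (3 * (B * √(m / n))) ^ 2 + (√(2 * (2 / l₀ + 1)) * (M * √(l / n))) ^ 2 := by
        simp only [mul_pow, hx, hy, hz]
        ring
    _ ≤ _ := by
        have : 0 ≤ (3 * (B * √(m / n))) * (√(2 * (2 / l₀ + 1)) * (M * √(l / n))) := by positivity
        nlinarith

/-- Makes net entropy linear in D = K/a, using D ≤ exp(D - 1) instead of a logarithm. -/
theorem three_mul_two_pow_mul_le_exp {D : ℝ} (hD : 1 ≤ D) (k : ℕ) :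
    3 * 2 ^ k * D ≤ Real.exp ((k + 2) * D) := by
  have h1 : (2 : ℝ) ≤ Real.exp 1 := by linarith [Real.add_one_le_exp (1 : ℝ)]
  have h2 : D ≤ Real.exp (D - 1) := by linarith [Real.add_one_le_exp (D - 1)]
  have h3 : (3 : ℝ) ≤ Real.exp 2 := by linarith [Real.add_one_le_exp (2 : ℝ)]
  have hk : (0 : ℝ) ≤ k := k.cast_nonneg
  calc 3 * 2 ^ k * D ≤ Real.exp 2 * Real.exp 1 ^ k * Real.exp (D - 1) := by gcongr
    _ = Real.exp (2 + k * 1 + (D - 1)) := by rw [Real.exp_add, Real.exp_add, Real.exp_nat_mul]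
    _ ≤ Real.exp ((k + 2) * D) := by
        apply Real.exp_le_exp.2
        nlinarith

variable {E : Type*} [NormedAddCommGroup E] [NormedSpace ℝ E] [FiniteDimensional ℝ E]

open Module in
/-- Chaining from the scale `a`, where the first net has metric entropy `dim E * h`. -/
theorem exists_event_uniform_deviation_of_net (hn : 0 < n) (hξ : ∀ i, Measurable (ξ i))
    (hind : iIndepFun ξ P) (hlaw : ∀ i, P.map (ξ i) = q) {Θ : Set E} {F : E → α → ℝ}
    {K L M a h : ℝ} (hF : ∀ θ ∈ Θ, Measurable (F θ)) (hL : 0 ≤ L)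
    (hM : 0 ≤ M) (hΘ : ∀ θ ∈ Θ, ‖θ‖ ≤ K) (hFM : ∀ θ ∈ Θ, ∀ x, |F θ x| ≤ M)
    (hFL : ∀ θ ∈ Θ, ∀ θ' ∈ Θ, ∀ x, |F θ x - F θ' x| ≤ L * ‖θ - θ'‖)
    (ha : 0 < a) (haK : a ≤ K) (haM : L * a ≤ M) (hh : 0 ≤ h)
    (hMh : M ^ 2 * h ≤ 4 * (L * K) ^ 2) (N₀ : Finset E) (hN₀ : ∀ θ ∈ N₀, θ ∈ Θ)
    (hcard₀ : (N₀.card : ℝ) ≤ Real.exp (finrank ℝ E * h))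
    (hcard₀' : (N₀.card : ℝ) ≤ Real.exp (finrank ℝ E * (2 * (K / a))))
    (hnet₀ : ∀ θ ∈ Θ, ∃ θ' ∈ N₀, ‖θ - θ'‖ ≤ 2 * a)
    {δ δ₀ : ℝ} (hδ : 0 < δ) (hδδ₀ : δ ≤ δ₀) (hδ₀ : δ₀ < 1) :
    ∃ G : Set Ω, MeasurableSet G ∧ 1 - δ ≤ P.real G ∧ ∀ ω ∈ G, ∀ θ ∈ Θ,
      |deviation q ξ (F θ) ω| ≤ 51 * (L * K * √(finrank ℝ E / n)) +
        25 * √(2 * (2 / Real.log (1 / δ₀) + 1)) * (M * √(Real.log (1 / δ) / n)) := by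
  have hn' : (0 : ℝ) < n := by exact_mod_cast hn
  have hK : 0 < K := ha.trans_le haK
  set D : ℝ := K / a with hDdef
  have hD : 1 ≤ D := by rwa [hDdef, le_div_iff₀ ha, one_mul]
  have hDa : D * a = K := by rw [hDdef]; field_simp
  set m : ℝ := (finrank ℝ E : ℝ) with hm
  have hm0 : 0 ≤ m := Nat.cast_nonneg _
  have hl₀ : 0 < Real.log (1 / δ₀) :=
    Real.log_pos (by rw [lt_div_iff₀ (hδ.trans_le hδδ₀)]; linarith)
  have hl : Real.log (1 / δ₀) ≤ Real.log (1 / δ) :=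
    Real.log_le_log (by have := hδ.trans_le hδδ₀; positivity) (one_div_le_one_div_of_le hδ hδδ₀)
  -- The nets have scale a/2^k; the weaker 2a/2^k matches level 0, where a = K allows a single
  -- point.
  have hnets : ∀ k : ℕ, ∃ N : Finset E, (∀ θ ∈ N, θ ∈ Θ) ∧
      (N.card : ℝ) ≤ Real.exp (m * ((k + 2) * D)) ∧
      ∀ θ ∈ Θ, ∃ θ' ∈ N, ‖θ - θ'‖ ≤ 2 * a / 2 ^ k := by
    intro k
    have h1 : (1 : ℝ) ≤ 2 ^ k := one_le_pow₀ one_le_two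
    obtain ⟨N, hN, hcard, hnet⟩ := exists_finset_net Θ (K := K) (η := a / 2 ^ k) (by positivity)
      ((div_le_self ha.le h1).trans haK) hΘ
    refine ⟨N, hN, hcard.trans ?_, fun θ hθ => ?_⟩
    · have : 3 * K / (a / 2 ^ k) = 3 * 2 ^ k * D := by rw [hDdef]; field_simp
      rw [this, hm, Real.exp_nat_mul]
      exact pow_le_pow_left₀ (by positivity) (three_mul_two_pow_mul_le_exp hD k) _
    · obtain ⟨θ', hθ', h⟩ := hnet θ hθ
      exact ⟨θ', hθ', h.trans (by gcongr; linarith)⟩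
  choose N' hN' hcard' hnet' using hnets
  let N : ℕ → Finset E := fun k => Nat.casesOn k N₀ fun j => N' (j + 1)
  have hN : ∀ k, ∀ θ ∈ N k, θ ∈ Θ := by
    rintro (_ | k)
    exacts [hN₀, hN' (k + 1)]
  have hcard : ∀ k : ℕ, ((N k).card : ℝ) ≤ Real.exp (m * ((k + 2) * D)) := by
    rintro (_ | k)
    · simpa [N] using hcard₀'
    · exact hcard' (k + 1)
  have hnet : ∀ k, ∀ θ ∈ Θ, ∃ θ' ∈ N k, ‖θ - θ'‖ ≤ 2 * a / 2 ^ k := by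
    rintro (_ | k)
    · simpa [N] using hnet₀
    · exact hnet' (k + 1)
  -- Level 0 holds the starting functions F θ, and level k + 1 all differences between points of the
  -- nets k and k + 1.
  let s : ℕ → Finset (E ⊕ E × E) := fun k =>
    Nat.casesOn k (N₀.map Function.Embedding.inl)
      fun j => (N j ×ˢ N (j + 1)).map Function.Embedding.inr
  let g : E ⊕ E × E → α → ℝ := Sum.elim F fun p x => F p.1 x - F p.2 x
  let b : E ⊕ E × E → ℝ := Sum.elim (fun _ => M) fun p => L * ‖p.1 - p.2‖
  let e : ℕ → ℝ := fun k => Nat.casesOn k (m * h) fun j => 2 * m * (j + 3) * D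
  have he : ∀ k, 0 ≤ e k := by
    rintro (_ | k)
    · exact mul_nonneg hm0 hh
    · show 0 ≤ 2 * m * (k + 3) * D
      positivity
  have hs : ∀ k, ∀ i ∈ s k, Measurable (g i) ∧ ∀ x, |g i x| ≤ b i := by
    rintro (_ | k) i hi
    · obtain ⟨θ, hθ, rfl⟩ := Finset.mem_map.1 hi
      exact ⟨hF θ (hN₀ θ hθ), hFM θ (hN₀ θ hθ)⟩
    · obtain ⟨⟨θ, θ'⟩, hθ, rfl⟩ := Finset.mem_map.1 hi
      obtain ⟨h1, h2⟩ := Finset.mem_product.1 hθ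
      have h1' := hN k θ h1
      have h2' := hN (k + 1) θ' h2
      exact ⟨(hF θ h1').sub (hF θ' h2'), hFL θ h1' θ' h2'⟩
  have hb0 : ∀ i, 0 ≤ b i := by
    rintro (θ | p)
    · exact hM
    · exact mul_nonneg hL (norm_nonneg _)
  have hcards : ∀ k, ((s k).card : ℝ) ≤ Real.exp (e k) := by
    rintro (_ | k)
    · simpa [s, e] using hcard₀
    · simp only [s, e, Finset.card_map, Finset.card_product, Nat.cast_mul]
      calc ((N k).card : ℝ) * (N (k + 1)).card
          ≤ Real.exp (m * ((k + 2) * D)) * Real.exp (m * (((k + 1 : ℕ) + 2) * D)) :=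
            mul_le_mul (hcard k) (hcard (k + 1)) (Nat.cast_nonneg _) (Real.exp_pos _).le
        _ = Real.exp (m * ((k + 2) * D) + m * (((k + 1 : ℕ) + 2) * D)) := (Real.exp_add _ _).symm
        _ ≤ _ := by
            apply Real.exp_le_exp.2
            push_cast
            have : 0 ≤ m * D := by positivity
            nlinarith
  obtain ⟨G, hGm, hGP, hG⟩ := exists_event_forall_abs_deviation_le (q := q) (P := P) hn hξ hind
    hlaw s g b e he (fun k i hi => (hs k i hi).1) hb0 (fun k i hi => (hs k i hi).2) hcards hδ
    (hδδ₀.trans_lt hδ₀)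
  refine ⟨G, hGm, hGP, fun ω hω θ hθ => ?_⟩
  choose p hpN hp using fun k => hnet k θ hθ
  have hpΘ : ∀ k, p k ∈ Θ := fun k => hN k _ (hpN k)
  have hint : ∀ θ ∈ Θ, Integrable (F θ) q := fun θ hθ =>
    integrable_of_abs_le (hF θ hθ) (hFM θ hθ)
  have hlip : ∀ θ ∈ Θ, ∀ θ' ∈ Θ,
      |deviation q ξ (F θ) ω - deviation q ξ (F θ') ω| ≤ 2 * (L * ‖θ - θ'‖) := by
    intro θ hθ θ' hθ'
    rw [deviation_sub (hint θ hθ) (hint θ' hθ')]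
    exact abs_deviation_le (by positivity) (hFL θ hθ θ' hθ') ω
  -- The deviation is 2L-Lipschitz in θ for every ω, so the chain converges without excluding
  -- further events.
  have hlim : Filter.Tendsto (fun k => deviation q ξ (F (p k)) ω) Filter.atTop
      (nhds (deviation q ξ (F θ) ω)) := by
    rw [tendsto_iff_dist_tendsto_zero]
    have h0 : Filter.Tendsto (fun k : ℕ => 4 * L * a * (1 / 2 : ℝ) ^ k) Filter.atTop (nhds 0) := by
      simpa using (tendsto_pow_atTop_nhds_zero_of_lt_one (r := (1 / 2 : ℝ)) (by norm_num)
        (by norm_num)).const_mul (4 * L * a)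
    refine squeeze_zero (fun _ => dist_nonneg) (fun k => ?_) h0
    rw [dist_comm, Real.dist_eq]
    refine (hlip θ hθ _ (hpΘ k)).trans ?_
    calc 2 * (L * ‖θ - p k‖) ≤ 2 * (L * (2 * a / 2 ^ k)) := by gcongr; exact hp k
      _ = _ := by rw [one_div, inv_pow]; ring
  have hstart : |deviation q ξ (F (p 0)) ω| ≤ M * √(2 * (m * h + 2 + Real.log (1 / δ)) / n) := by
    simpa [g, b, e] using hG ω hω 0 (Sum.inl (p 0)) (Finset.mem_map_of_mem _ (hpN 0))
  have hlink : ∀ k : ℕ, |deviation q ξ (F (p k)) ω - deviation q ξ (F (p (k + 1))) ω| ≤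
      3 * (L * a) * (2 * D * √(m / n) + √(2 * (2 / Real.log (1 / δ₀) + 1)) *
        √(Real.log (1 / δ) / n)) * ((k + 3) / 2 ^ k) := by
    intro k
    rw [deviation_sub (hint _ (hpΘ k)) (hint _ (hpΘ (k + 1)))]
    have h1 := hG ω hω (k + 1) (Sum.inr (p k, p (k + 1)))
      (Finset.mem_map_of_mem _ (Finset.mem_product.2 ⟨hpN k, hpN (k + 1)⟩))
    have h2 : ‖p k - p (k + 1)‖ ≤ 3 * a / 2 ^ k := by
      have h3 : ‖p k - p (k + 1)‖ ≤ ‖θ - p k‖ + ‖θ - p (k + 1)‖ := by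
        rw [norm_sub_rev θ (p k)]
        simpa using norm_add_le (p k - θ) (θ - p (k + 1))
      have h4 : 2 * a / 2 ^ k + 2 * a / 2 ^ (k + 1) = 3 * a / 2 ^ k := by
        field_simp
        ring
      linarith [hp k, hp (k + 1)]
    have h5 : e (k + 1) + (((k + 1 : ℕ) : ℝ) + 2) + Real.log (1 / δ)
        = 2 * m * (k + 3) * D + (k + 3) + Real.log (1 / δ) := by
      simp only [e]
      push_cast
      ring
    rw [h5] at h1
    refine h1.trans ?_
    calc L * ‖p k - p (k + 1)‖ * √(2 * (2 * m * (k + 3) * D + (k + 3) + Real.log (1 / δ)) / n)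
        ≤ L * (3 * a / 2 ^ k) * ((k + 3) * (2 * D * √(m / n) +
            √(2 * (2 / Real.log (1 / δ₀) + 1)) * √(Real.log (1 / δ) / n))) := by
          gcongr
          exact sqrt_link_le k hm0 hn' hD hl₀ hl
      _ = _ := by ring
  have hchain := abs_le_of_chain (by positivity) hstart hlink hlim
  have hs0 := mul_sqrt_start_le (n := n) hm0 hn' hM hh (by positivity : 0 ≤ L * K) hMh hl₀ hl
  have hc0 : 0 ≤ √(2 * (2 / Real.log (1 / δ₀) + 1)) * √(Real.log (1 / δ) / n) := by positivity
  have hend : 8 * (3 * (L * a) * (2 * D * √(m / n) + √(2 * (2 / Real.log (1 / δ₀) + 1)) *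
        √(Real.log (1 / δ) / n))) ≤ 48 * (L * K * √(m / n)) +
      24 * √(2 * (2 / Real.log (1 / δ₀) + 1)) * (M * √(Real.log (1 / δ) / n)) := by
    have h1 : 8 * (3 * (L * a) * (2 * D * √(m / n) + √(2 * (2 / Real.log (1 / δ₀) + 1)) *
        √(Real.log (1 / δ) / n))) = 48 * (L * (D * a) * √(m / n)) +
        24 * (L * a * (√(2 * (2 / Real.log (1 / δ₀) + 1)) * √(Real.log (1 / δ) / n))) := by ring
    -- The entropy part uses aD = K, the confidence part La ≤ M. With the start this gives 51 = 48 +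
    -- 3 and 25 = 24 + 1.
    rw [h1, hDa]
    have h2 := mul_le_mul_of_nonneg_right haM hc0
    linarith
  linarith

open Module in
/-- Uniform deviation bound for a bounded class of functions that depends on a bounded
finite-dimensional parameter in a Lipschitz way. -/
theorem exists_event_uniform_deviation (hn : 0 < n) (hξ : ∀ i, Measurable (ξ i))
    (hind : iIndepFun ξ P) (hlaw : ∀ i, P.map (ξ i) = q) {Θ : Set E} {F : E → α → ℝ}
    {K L M : ℝ} (hF : ∀ θ ∈ Θ, Measurable (F θ)) (hK : 0 < K) (hL : 0 ≤ L)
    (hM : 0 ≤ M) (hΘ : ∀ θ ∈ Θ, ‖θ‖ ≤ K) (hFM : ∀ θ ∈ Θ, ∀ x, |F θ x| ≤ M)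
    (hFL : ∀ θ ∈ Θ, ∀ θ' ∈ Θ, ∀ x, |F θ x - F θ' x| ≤ L * ‖θ - θ'‖)
    {δ δ₀ : ℝ} (hδ : 0 < δ) (hδδ₀ : δ ≤ δ₀) (hδ₀ : δ₀ < 1) :
    ∃ G : Set Ω, MeasurableSet G ∧ 1 - δ ≤ P.real G ∧ ∀ ω ∈ G, ∀ θ ∈ Θ,
      |deviation q ξ (F θ) ω| ≤ 51 * (L * K * √(finrank ℝ E / n)) +
        25 * √(2 * (2 / Real.log (1 / δ₀) + 1)) * (M * √(Real.log (1 / δ) / n)) := by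
  rcases Θ.eq_empty_or_nonempty with rfl | ⟨θ₀, hθ₀⟩
  · exact ⟨Set.univ, MeasurableSet.univ, by rw [probReal_univ]; linarith, by simp⟩
  -- If LK ≤ M, a single point is a net at scale 2K, so one may start from a = K with entropy h = 0.
  rcases le_or_gt (L * K) M with hLK | hLK
  · refine exists_event_uniform_deviation_of_net hn hξ hind hlaw hF hL hM hΘ hFM hFL hK le_rfl hLK
      le_rfl (by simp only [mul_zero]; positivity) {θ₀} (by simpa using hθ₀) (by simp) ?_ ?_ hδ
      hδδ₀ hδ₀
    · rw [Finset.card_singleton, Nat.cast_one]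
      exact Real.one_le_exp (by positivity)
    · intro θ hθ
      refine ⟨θ₀, by simp, (norm_sub_le _ _).trans ?_⟩
      linarith [hΘ θ hθ, hΘ θ₀ hθ₀]
  rcases hM.eq_or_lt with rfl | hM0
  · refine ⟨Set.univ, MeasurableSet.univ, by rw [probReal_univ]; linarith, fun ω _ θ hθ => ?_⟩
    refine (abs_deviation_le le_rfl (hFM θ hθ) ω).trans ?_
    rw [mul_zero, zero_mul, mul_zero, add_zero]
    positivity
  have hL0 : 0 < L := by
    rcases hL.eq_or_lt with rfl | h
    · simp only [zero_mul] at hLK; linarith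
    · exact h
  -- Starting from a = M/L makes La equal to M; with h = 2K/a, M²h = 2M·LK ≤ 4(LK)² because M < LK.
  have ha : 0 < M / L := by positivity
  have haK : M / L ≤ K := by rw [div_le_iff₀ hL0]; linarith
  obtain ⟨N₀, hN₀, hcard, hnet⟩ := exists_finset_net Θ ha haK hΘ
  have hD : 1 ≤ K / (M / L) := by rwa [le_div_iff₀ ha, one_mul]
  have hcard' : (N₀.card : ℝ) ≤ Real.exp (finrank ℝ E * (2 * (K / (M / L)))) := by
    refine hcard.trans ?_
    rw [Real.exp_nat_mul]
    refine pow_le_pow_left₀ (by positivity) ?_ _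
    have := three_mul_two_pow_mul_le_exp hD 0
    simpa [mul_div_assoc] using this
  refine exists_event_uniform_deviation_of_net hn hξ hind hlaw hF hL hM hΘ hFM hFL ha haK
    (by rw [mul_div_cancel₀ _ hL0.ne']) (by positivity) ?_ N₀ hN₀ hcard' hcard'
    (fun θ hθ => ?_) hδ hδδ₀ hδ₀
  · have : M ^ 2 * (2 * (K / (M / L))) = 2 * (M * (L * K)) := by field_simp
    rw [this]
    nlinarith [mul_pos hM0 (hM0.trans hLK)]
  · obtain ⟨θ', hθ', h⟩ := hnet θ hθ
    exact ⟨θ', hθ', h.trans (by linarith)⟩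

end Chaining

/-! ### Stability and measurability of trajectories and returns. -/

section Trajectory

variable {S A Ξ : Type*} {T : ℕ}

theorem geomQuotient_succ (ν : ℝ) (t : ℕ) : geomQuotient ν (t + 1) = 1 + ν * geomQuotient ν t := by
  unfold geomQuotient
  rw [Finset.sum_range_succ', Finset.mul_sum, pow_zero, add_comm]
  simp only [pow_succ']

theorem geomQuotient_nonneg {ν : ℝ} (hν : 0 ≤ ν) (t : ℕ) : 0 ≤ geomQuotient ν t :=
  Finset.sum_nonneg fun _ _ => pow_nonneg hν _

/-- A discrete Grönwall bound for two trajectories driven by the same noise. -/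
theorem dist_trajectory_le [PseudoMetricSpace S] {trans trans' : S → A → Ξ → S} {init init' : Ξ → S}
    {act act' : S → A} {ν c ε : ℝ} (hν : 0 ≤ ν)
    (h : ∀ s s' x, dist (trans s (act s) x) (trans' s' (act' s') x) ≤ ν * dist s s' + c)
    (hinit : ∀ x, dist (init x) (init' x) ≤ ε) (ξ : Fin (T + 1) → Ξ) (t : Fin (T + 1)) :
    dist (trajectory trans init act ξ t) (trajectory trans' init' act' ξ t)
      ≤ c * geomQuotient ν t + ε * ν ^ (t : ℕ) := by
  induction t using Fin.induction with
  | zero => simpa [trajectory_zero, geomQuotient] using hinit (ξ 0)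
  | succ t ih =>
    rw [trajectory_succ, trajectory_succ, Fin.val_succ, geomQuotient_succ, pow_succ']
    refine (h _ _ _).trans ?_
    have := mul_le_mul_of_nonneg_left ih hν
    rw [Fin.val_castSucc] at this
    linarith

theorem measurable_trajectory [MeasurableSpace S] [MeasurableSpace A] [MeasurableSpace Ξ]
    {trans : S → A → Ξ → S} {init : Ξ → S} {act : S → A}
    (htrans : Measurable fun p : S × A × Ξ => trans p.1 p.2.1 p.2.2) (hinit : Measurable init)
    (hact : Measurable act) (t : Fin (T + 1)) :
    Measurable fun ξ : Fin (T + 1) → Ξ => trajectory trans init act ξ t := by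
  induction t using Fin.induction with
  | zero => exact hinit.comp (measurable_pi_apply 0)
  | succ t ih =>
    exact htrans.comp (ih.prodMk ((hact.comp ih).prodMk (measurable_pi_apply t.castSucc)))

theorem measurable_discountedReturn [MeasurableSpace S] [MeasurableSpace Ξ] (γ : ℝ)
    {r : S → A → ℝ} {act : S → A} (hr : Measurable fun s => r s (act s))
    {τ : (Fin (T + 1) → Ξ) → Fin (T + 1) → S} (hτ : ∀ t, Measurable fun ξ => τ ξ t) :
    Measurable fun ξ => discountedReturn γ r act (τ ξ) :=
  Finset.measurable_sum _ fun t _ => (hr.comp (hτ t)).const_mul _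

/-- Here ρ carries the part of the action mismatch not caused by state distance: a change of
parameter, or the distractor. -/
theorem abs_discountedReturn_sub_le [PseudoMetricSpace S] {γ : ℝ} (hγ : 0 ≤ γ) {r : S → A → ℝ}
    {act act' : S → A} {lam ρ : ℝ} (hlam : 0 ≤ lam)
    (h : ∀ s s', |r s (act s) - r s' (act' s')| ≤ lam * dist s s' + ρ)
    {s s' : Fin (T + 1) → S} {d : ℕ → ℝ} (hd : ∀ t, dist (s t) (s' t) ≤ d t) :
    |discountedReturn γ r act s - discountedReturn γ r act' s'|
      ≤ ∑ t ∈ Finset.range (T + 1), γ ^ t * (lam * d t + ρ) := by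
  unfold discountedReturn
  rw [← Finset.sum_sub_distrib, ← Fin.sum_univ_eq_sum_range fun t => γ ^ t * (lam * d t + ρ)]
  refine (Finset.abs_sum_le_sum_abs _ _).trans (Finset.sum_le_sum fun t _ => ?_)
  rw [← mul_sub, abs_mul, abs_of_nonneg (pow_nonneg hγ _)]
  have h1 := h (s t) (s' t)
  have h2 := mul_le_mul_of_nonneg_left (hd t) hlam
  exact mul_le_mul_of_nonneg_left (by linarith) (pow_nonneg hγ _)

theorem sum_range_pow_eq {γ : ℝ} (hγ : γ < 1) (N : ℕ) :
    ∑ t ∈ Finset.range N, γ ^ t = (1 - γ ^ N) / (1 - γ) := by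
  rw [geom_sum_eq hγ.ne, ← neg_div_neg_eq, neg_sub, neg_sub]

theorem abs_discountedReturn_le {γ : ℝ} (hγ : 0 ≤ γ) (hγ1 : γ < 1) {r : S → A → ℝ} {rmax : ℝ}
    (hr : ∀ s a, |r s a| ≤ rmax) (act : S → A) (s : Fin (T + 1) → S) :
    |discountedReturn γ r act s| ≤ (1 - γ ^ (T + 1)) / (1 - γ) * rmax := by
  unfold discountedReturn
  rw [← sum_range_pow_eq hγ1, Finset.sum_mul, ← Fin.sum_univ_eq_sum_range fun t => γ ^ t * rmax]
  refine (Finset.abs_sum_le_sum_abs _ _).trans (Finset.sum_le_sum fun t _ => ?_)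
  rw [abs_mul, abs_of_nonneg (pow_nonneg hγ _)]
  exact mul_le_mul_of_nonneg_left (hr _ _) (pow_nonneg hγ _)

end Trajectory

end VisualRL

/-! ### The generalization bound. -/

theorem mainTheorem6 :
    ∃ C₁ : ℝ, ∀ δ₀ : ℝ, 0 < δ₀ → δ₀ < 1 → ∃ C₂ : ℝ,
    -- state, action and representation spaces, and the noise space
    ∀ (S A Φ Ξ Ω : Type*)
      [MetricSpace S] [SecondCountableTopology S] [MeasurableSpace S] [BorelSpace S]
      [MetricSpace A] [MeasurableSpace A] [BorelSpace A]
      [MetricSpace Φ] [MeasurableSpace Ξ] [MeasurableSpace Ω]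
      -- horizon, discount factor, dimension of the policy parameter, number of episodes
      (T : ℕ) (γ : ℝ) (m n : ℕ)
      -- policy parameters and policy, encoder, distractor, reward
      (Θ : Set (EuclideanSpace ℝ (Fin m))) (π : Φ → EuclideanSpace ℝ (Fin m) → A)
      (φ : S → Φ) (f : S → S) (r : S → A → ℝ)
      -- transitions and initializations of the training and of the testing environment
      (trans trans' : S → A → Ξ → S) (init init' : Ξ → S)
      (Lt₁ Lt₂ Lπ₁ Lπ₂ Lr₁ Lr₂ Lφ rmax ζ ε ϱ K ν lam LJ : ℝ)
      -- law of the noise of an episode, and the noises of the `n` training episodes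
      (q : Measure (Fin (T + 1) → Ξ)) [IsProbabilityMeasure q]
      (P : Measure Ω) [IsProbabilityMeasure P] (ξ : Fin n → Ω → Fin (T + 1) → Ξ) (δ : ℝ),
      0 ≤ γ → γ < 1 → 0 < n → 0 < δ → δ ≤ δ₀ →
      0 ≤ Lt₁ → 0 ≤ Lt₂ → 0 ≤ Lπ₁ → 0 ≤ Lπ₂ → 0 ≤ Lr₁ → 0 ≤ Lr₂ → 0 ≤ Lφ → 0 < K →
      -- measurability
      Measurable (fun p : S × A × Ξ => trans p.1 p.2.1 p.2.2) →
      Measurable (fun p : S × A × Ξ => trans' p.1 p.2.1 p.2.2) →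
      Measurable init → Measurable init' → Measurable f →
      -- the training transition is Lipschitz in the state and in the action
      (∀ s s' a x, dist (trans s a x) (trans s' a x) ≤ Lt₁ * dist s s') →
      (∀ s a a' x, dist (trans s a x) (trans s a' x) ≤ Lt₂ * dist a a') →
      -- the policy is Lipschitz in the representation and in the parameter
      (∀ y y', ∀ θ ∈ Θ, dist (π y θ) (π y' θ) ≤ Lπ₁ * dist y y') →
      (∀ y, ∀ θ ∈ Θ, ∀ θ' ∈ Θ, dist (π y θ) (π y θ') ≤ Lπ₂ * ‖θ - θ'‖) →
      -- the reward is bounded, and Lipschitz in the state and in the action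
      (∀ s a, |r s a| ≤ rmax) →
      (∀ s s' a, |r s a - r s' a| ≤ Lr₁ * dist s s') →
      (∀ s a a', |r s a - r s a'| ≤ Lr₂ * dist a a') →
      -- the training and the testing environments are close
      (∀ s a x, dist (trans s a x) (trans' s a x) ≤ ζ) →
      (∀ x, dist (init x) (init' x) ≤ ε) →
      -- the encoder is Lipschitz, and the representation deviation is bounded
      (∀ s s', dist (φ s) (φ s') ≤ Lφ * dist s s') →
      (∀ s, dist (φ (f s)) (φ s) ≤ ϱ) →
      -- the policy parameters are bounded
      (∀ θ ∈ Θ, ‖θ‖ ≤ K) →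
      -- the noises of the training episodes are i.i.d. with law `q`
      (∀ i, Measurable (ξ i)) → iIndepFun ξ P → (∀ i, P.map (ξ i) = q) →
      ν = Lt₁ + Lt₂ * Lπ₁ * Lφ →
      lam = Lr₁ + Lr₂ * Lπ₁ * Lφ →
      LJ = VisualRL.returnLipschitzConst T γ lam ν Lt₂ Lπ₂ Lr₂ →
      ∃ E : Set Ω, MeasurableSet E ∧ 1 - δ ≤ P.real E ∧ ∀ ω ∈ E, ∀ θ ∈ Θ,
        |(∫ x, VisualRL.testReturn γ r φ f π trans' init' θ x ∂q)
            - (1 / (n : ℝ)) * ∑ i, VisualRL.trainReturn γ r φ π trans init θ (ξ i ω)|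
          ≤ lam * ζ * ∑ t ∈ Finset.range (T + 1), γ ^ t * VisualRL.geomQuotient ν t
            + lam * ε * ∑ t ∈ Finset.range (T + 1), γ ^ t * ν ^ t
            + Lr₂ * Lπ₁ * ϱ / (1 - γ) * (1 - γ ^ (T + 1))
            + C₁ * (LJ * K * √((m : ℝ) / n))
            + C₂ * ((1 - γ ^ (T + 1)) / (1 - γ) * rmax * √(Real.log (1 / δ) / n)) := by
  refine ⟨51, fun δ₀ _ hδ₀1 => ⟨25 * √(2 * (2 / Real.log (1 / δ₀) + 1)), ?_⟩⟩
  intro S A Φ Ξ Ω _ _ _ _ _ _ _ _ _ _ T γ m n Θ π φ f r trans trans' init init'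
    Lt₁ Lt₂ Lπ₁ Lπ₂ Lr₁ Lr₂ Lφ rmax ζ ε ϱ K ν lam LJ q _ P _ ξ δ
    hγ hγ1 hn hδ hδδ₀ hLt₁ hLt₂ hLπ₁ hLπ₂ hLr₁ hLr₂ hLφ hK htm htm' him him' hfm
    htLs htLa hπy hπθ hrb hrs hra htt hii hφ hφf hΘ hξm hξi hξl hν hlam hLJ
  rcases Θ.eq_empty_or_nonempty with rfl | ⟨θ₀, -⟩
  · exact ⟨Set.univ, MeasurableSet.univ, by rw [probReal_univ]; linarith, by simp⟩
  have hν0 : 0 ≤ ν := by rw [hν]; positivity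
  have hlam0 : 0 ≤ lam := by rw [hlam]; positivity
  have hLJ0 : 0 ≤ LJ := by
    rw [hLJ]
    refine Finset.sum_nonneg fun t _ => ?_
    have := VisualRL.geomQuotient_nonneg hν0 t
    positivity
  -- A probability measure forces the noise space to be nonempty, so some state-action pair exists.
  have hrmax : 0 ≤ rmax := by
    obtain ⟨x⟩ := q.nonempty_of_neZero
    exact (abs_nonneg _).trans (hrb (init (x 0)) (π (φ (init (x 0))) θ₀))
  have hsum : 0 ≤ (1 - γ ^ (T + 1)) / (1 - γ) := by
    rw [← VisualRL.sum_range_pow_eq hγ1]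
    positivity
  -- Lipschitz estimates for the closed-loop policy and reward
  have hact : ∀ θ ∈ Θ, ∀ s s', dist (π (φ s) θ) (π (φ s') θ) ≤ Lπ₁ * Lφ * dist s s' := by
    intro θ hθ s s'
    have := mul_le_mul_of_nonneg_left (hφ s s') hLπ₁
    linarith [hπy (φ s) (φ s') θ hθ]
  have hrew : ∀ s s' a a', |r s a - r s' a'| ≤ Lr₁ * dist s s' + Lr₂ * dist a a' := fun s s' a a' =>
    (abs_sub_le _ _ _).trans (add_le_add (hrs s s' a) (hra s' a a'))
  have htr : ∀ s s' a a' x,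
      dist (trans s a x) (trans s' a' x) ≤ Lt₁ * dist s s' + Lt₂ * dist a a' := fun s s' a a' x =>
    (dist_triangle _ _ _).trans (add_le_add (htLs s s' a x) (htLa s' a a' x))
  have hactm : ∀ θ ∈ Θ, Measurable fun s => π (φ s) θ := fun θ hθ =>
    (LipschitzWith.of_dist_le' (hact θ hθ)).continuous.measurable
  -- Continuity on S × S, with S second countable, avoids measurability of r on S × A. The pairs (s,
  -- s) and (s, f s) then give the training and test rewards.
  have hrewm : ∀ θ ∈ Θ, Measurable fun p : S × S => r p.1 (π (φ p.2) θ) := by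
    intro θ hθ
    refine (LipschitzWith.of_dist_le' (K := Lr₁ + Lr₂ * (Lπ₁ * Lφ))
      fun p p' => ?_).continuous.measurable
    rw [Real.dist_eq]
    refine (hrew _ _ _ _).trans ?_
    have h1 := mul_le_mul_of_nonneg_left (hact θ hθ p.2 p'.2) hLr₂
    have h2 : dist p.1 p'.1 ≤ dist p p' := le_max_left _ _
    have h3 : dist p.2 p'.2 ≤ dist p p' := le_max_right _ _
    have h4 := mul_le_mul_of_nonneg_left h2 hLr₁
    have h5 := mul_le_mul_of_nonneg_left h3 (by positivity : 0 ≤ Lr₂ * (Lπ₁ * Lφ))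
    linarith
  -- the training return
  have htrain : ∀ θ ∈ Θ, Measurable (VisualRL.trainReturn γ r φ π trans init θ (T := T)) :=
    fun θ hθ => VisualRL.measurable_discountedReturn γ
      ((hrewm θ hθ).comp (measurable_id.prodMk measurable_id))
      fun t => VisualRL.measurable_trajectory htm him (hactm θ hθ) t
  have htest : ∀ θ ∈ Θ, Measurable (VisualRL.testReturn γ r φ f π trans' init' θ (T := T)) :=
    fun θ hθ => VisualRL.measurable_discountedReturn γ
      ((hrewm θ hθ).comp (measurable_id.prodMk hfm))
      fun t => VisualRL.measurable_trajectory htm' him' (hactm θ hθ) t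
  have htrain_le : ∀ θ ∈ Θ, ∀ x, |VisualRL.trainReturn γ r φ π trans init θ (T := T) x|
      ≤ (1 - γ ^ (T + 1)) / (1 - γ) * rmax :=
    fun θ _ x => VisualRL.abs_discountedReturn_le hγ hγ1 hrb _ _
  have htest_le : ∀ θ ∈ Θ, ∀ x, |VisualRL.testReturn γ r φ f π trans' init' θ (T := T) x|
      ≤ (1 - γ ^ (T + 1)) / (1 - γ) * rmax :=
    fun θ _ x => VisualRL.abs_discountedReturn_le hγ hγ1 hrb _ _
  have hpol : ∀ θ ∈ Θ, ∀ θ' ∈ Θ, ∀ s s',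
      dist (π (φ s) θ) (π (φ s') θ') ≤ Lπ₁ * Lφ * dist s s' + Lπ₂ * ‖θ - θ'‖ :=
    fun θ hθ θ' hθ' s s' => (dist_triangle _ _ _).trans
      (add_le_add (hact θ hθ s s') (hπθ (φ s') θ hθ θ' hθ'))
  have hLip : ∀ θ ∈ Θ, ∀ θ' ∈ Θ, ∀ x, |VisualRL.trainReturn γ r φ π trans init θ (T := T) x -
      VisualRL.trainReturn γ r φ π trans init θ' x| ≤ LJ * ‖θ - θ'‖ := by
    intro θ hθ θ' hθ' x
    -- Same environment, two parameters: the initial states agree, and each step adds a drift of at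
    -- most Lt₂Lπ₂‖θ - θ'‖.
    have hd := VisualRL.dist_trajectory_le (trans := trans) (trans' := trans) (init := init)
      (init' := init) (act := fun s => π (φ s) θ) (act' := fun s => π (φ s) θ')
      (c := Lt₂ * (Lπ₂ * ‖θ - θ'‖)) (ε := 0) hν0 (fun s s' y => by
        have h1 := mul_le_mul_of_nonneg_left (hpol θ hθ θ' hθ' s s') hLt₂
        rw [hν]
        linarith [htr s s' (π (φ s) θ) (π (φ s') θ') y]) (fun y => (dist_self _).le) x
    refine (VisualRL.abs_discountedReturn_sub_le hγ hlam0 (ρ := Lr₂ * (Lπ₂ * ‖θ - θ'‖))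
      (d := fun t => Lt₂ * (Lπ₂ * ‖θ - θ'‖) * VisualRL.geomQuotient ν t + 0 * ν ^ t)
      (fun s s' => ?_) hd).trans (le_of_eq ?_)
    · have h1 := mul_le_mul_of_nonneg_left (hpol θ hθ θ' hθ' s s') hLr₂
      rw [hlam]
      linarith [hrew s s' (π (φ s) θ) (π (φ s') θ')]
    · rw [hLJ, VisualRL.returnLipschitzConst, Finset.sum_mul]
      exact Finset.sum_congr rfl fun t _ => by ring
  -- the discrepancy between training and testing
  have hbias : ∀ θ ∈ Θ, ∀ x, |VisualRL.testReturn γ r φ f π trans' init' θ (T := T) x -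
      VisualRL.trainReturn γ r φ π trans init θ x| ≤
        lam * ζ * ∑ t ∈ Finset.range (T + 1), γ ^ t * VisualRL.geomQuotient ν t
            + lam * ε * ∑ t ∈ Finset.range (T + 1), γ ^ t * ν ^ t
            + Lr₂ * Lπ₁ * ϱ / (1 - γ) * (1 - γ ^ (T + 1)) := by
    intro θ hθ x
    -- Same parameter, two environments. The distractor does not drive the dynamics, so ϱ enters
    -- only through the rewarded action, via ρ below.
    have hd := VisualRL.dist_trajectory_le (trans := trans) (trans' := trans') (init := init)
      (init' := init') (act := fun s => π (φ s) θ) (act' := fun s => π (φ s) θ)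
      (c := ζ) (ε := ε) hν0 (fun s s' y => by
        have h1 := mul_le_mul_of_nonneg_left (hact θ hθ s s') hLt₂
        have h2 := dist_triangle (trans s (π (φ s) θ) y) (trans s' (π (φ s') θ) y)
          (trans' s' (π (φ s') θ) y)
        rw [hν]
        linarith [htr s s' (π (φ s) θ) (π (φ s') θ) y, htt s' (π (φ s') θ) y]) hii x
    rw [abs_sub_comm]
    refine (VisualRL.abs_discountedReturn_sub_le hγ hlam0 (ρ := Lr₂ * (Lπ₁ * ϱ))
      (d := fun t => ζ * VisualRL.geomQuotient ν t + ε * ν ^ t)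
      (fun s s' => ?_) hd).trans (le_of_eq ?_)
    · have h1 : dist (π (φ s) θ) (π (φ (f s')) θ) ≤ Lπ₁ * Lφ * dist s s' + Lπ₁ * ϱ := by
        refine (dist_triangle _ (π (φ s') θ) _).trans (add_le_add (hact θ hθ s s') ?_)
        rw [dist_comm]
        exact (hπy _ _ θ hθ).trans (mul_le_mul_of_nonneg_left (hφf s') hLπ₁)
      have h2 := mul_le_mul_of_nonneg_left h1 hLr₂
      rw [hlam]
      linarith [hrew s s' (π (φ s) θ) (π (φ (f s')) θ)]
    · have h3 : Lr₂ * Lπ₁ * ϱ / (1 - γ) * (1 - γ ^ (T + 1)) =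
          ∑ t ∈ Finset.range (T + 1), Lr₂ * Lπ₁ * ϱ * γ ^ t := by
        rw [← Finset.mul_sum, VisualRL.sum_range_pow_eq hγ1]
        ring
      rw [h3, Finset.mul_sum, Finset.mul_sum, ← Finset.sum_add_distrib, ← Finset.sum_add_distrib]
      exact Finset.sum_congr rfl fun t _ => by ring
  obtain ⟨G, hGm, hGP, hG⟩ := VisualRL.exists_event_uniform_deviation (P := P) hn hξm hξi hξl
    (F := fun θ => VisualRL.trainReturn γ r φ π trans init θ) htrain hK hLJ0
    (mul_nonneg hsum hrmax) hΘ htrain_le hLip hδ hδδ₀ hδ₀1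
  refine ⟨G, hGm, hGP, fun ω hω θ hθ => ?_⟩
  have h1 := hG ω hω θ hθ
  rw [finrank_euclideanSpace_fin] at h1
  have h2 := norm_integral_le_of_norm_le_const (μ := q)
    (f := fun x => VisualRL.testReturn γ r φ f π trans' init' θ x -
      VisualRL.trainReturn γ r φ π trans init θ x) (Filter.Eventually.of_forall (hbias θ hθ))
  rw [probReal_univ, mul_one, Real.norm_eq_abs,
    integral_sub (VisualRL.integrable_of_abs_le (htest θ hθ) (htest_le θ hθ))
      (VisualRL.integrable_of_abs_le (htrain θ hθ) (htrain_le θ hθ))] at h2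
  have h3 := abs_sub_le (∫ x, VisualRL.testReturn γ r φ f π trans' init' θ x ∂q)
    (∫ x, VisualRL.trainReturn γ r φ π trans init θ x ∂q)
    ((1 / (n : ℝ)) * ∑ i, VisualRL.trainReturn γ r φ π trans init θ (ξ i ω))
  unfold VisualRL.deviation at h1
  linarith
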